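/- Let $\mathcal X_o,\mathcal X_u,\mathcal A$ be finite sets with $\mathcal A\neq\emptyset$, let $p(x_o',x_u'\mid x_o,x_u,a)$ be a transition probability on $\mathcal X_o\times\mathcal X_u$ controlled by $a\in\mathcal A$, let $c:\mathcal X_o\times\mathcal X_u\times\mathcal A\to[0,\infty)$ be a cost function, let $0\le\beta<1$, let $x_{o,0}\in\mathcal X_o$, and let $\alpha_u$ be a probability distribution on $\mathcal X_u$. *Local-state-information problem.* The state starts at $(x_{o,0},x_{u,0})$ with $x_{u,0}\sim\alpha_u$. A policy $\pi\in\Pi$ chooses $a_t$ at random with a law depending on $(x_{o,0},\dots,x_{o,t},a_0,\dots,a_{t-1})$ only, and has the cost $$V^\pi_{\alpha_u}(x_{o,0})=\mathbb E^\pi\Big[\sum_{t\ge0}\beta^t c(x_{o,t},x_{u,t},a_t)\,\Big|\,x_{o,0}\Big].$$ *Belief-augmented problem.* The state is $(x_o,b)$, where $b$ is a probability distribution on $\mathcal X_u$. The stage cost is $\bar c(x_o,b,a)=\sum_{x_u}b(x_u)c(x_o,x_u,a)$. From $(x_o,b)$ under $a$, the next observable substate $x_o'$ has the law $p(x_o'\mid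 x_o,b,a)=\sum_{x_u,x_u'}p(x_o',x_u'\mid x_o,x_u,a)b(x_u)$, and the next belief is $b'=T(x_o',x_o,b,a)$, where $$T(x_o',x_o,b,a)(x_u')=\frac{\sum_{x_u}p(x_o',x_u'\mid x_o,x_u,a)b(x_u)}{\sum_{\hat x_u,\hat x_u'}p(x_o',\hat x_u'\mid x_o,\hat x_u,a)b(\hat x_u)}$$ (the value of $T$ is immaterial where the denominator is $0$). Let $p(x_o',b'\mid x_o,b,a)$ denote the resulting transition law. For a randomized policy $\bar\pi\in\bar\Pi$ depending on the whole history of augmented states and past actions, started at $(x_{o,0},b_0)$, let $$\bar V^{\bar\pi}(x_{o,0},b_0)=\mathbb E^{\bar\pi}\Big[\sum_{t\ge0}\beta^t\bar c(x_{o,t},b_t,a_t)\Big],$$ and let $\Pi_{\rm MD}$ be the set of Markov deterministic policies $a_t=d_t(x_{o,t},b_t)$. Then, with $b_0=\alpha_u$, $$\inf_{\pi\in\Pi}V^\pi_{\alpha_u}(x_{o,0})=\inf_{\bar\pi\in\bar\Pi}\bar V^{\bar\pi}(x_{o,0},b_0)=\inf_{\pi\in\Pi_{\rm MD}}\bar V^{\pi}(x_{o,0},b_0)<\infty,$$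 and the last infimum is attained by some policy in $\Pi_{\rm MD}$. Moreover the optimal value $u(x_o,b)=\inf_{\bar\pi\in\bar\Pi}\bar V^{\bar\pi}(x_o,b)$ satisfies, for all $x_o\in\mathcal X_o$ and all probability distributions $b$ on $\mathcal X_u$, the Bellman equation $$u(x_o,b)=\min_{a\in\mathcal A}\Big\{\bar c(x_o,b,a)+\beta\sum_{x_o',b'}u(x_o',b')\,p(x_o',b'\mid x_o,b,a)\Big\}.$$ -/

import Mathlib

open MeasureTheory ProbabilityTheory
open scoped NNReal ENNReal

noncomputable section

namespace LSI

universe u v w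

/-! ## Controlled Markov chains with a partially visible state

A controlled chain has states `S`, actions `A` and transition law `q`. At each time the controller
sees `obs s : O` of the current state `s` (everything if `obs = id`). A countable or discrete
`S` is not required: every one-step law below is a `PMF`. -/

/-- What the controller knows when choosing the action at time `t`: the observations at the times
`0, …, t` and the actions at the times `0, …, t - 1`. -/
abbrev History (O : Type u) (A : Type v) (t : ℕ) : Type (max u v) :=
  (Fin (t + 1) → O) × (Fin t → A)

/-- A randomized history-dependent policy: for each time a map from histories to distributions
over the actions. -/
abbrev Policy (O : Type u) (A : Type v) : Type (max u v) :=
  ∀ t : ℕ, History O A t → PMF A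

/-- A Markov deterministic policy: the action at time `t` is a function of the current state. -/
abbrev MarkovPolicy (S : Type u) (A : Type v) : Type (max u v) :=
  ℕ → S → A

/-- A Markov deterministic policy, as a policy. -/
def MarkovPolicy.toPolicy {S : Type u} {A : Type v} (d : MarkovPolicy S A) : Policy S A :=
  fun t h => PMF.pure (d t (h.1 (Fin.last t)))

/-- A complete record of the states and actions at the times `0, …, n`. -/
def Record (S : Type u) (A : Type v) (n : ℕ) : Type (max u v) :=
  Fin (n + 1) → S × A

/-- Every set of records is measurable. -/
instance (S : Type u) (A : Type v) (n : ℕ) : MeasurableSpace (Record S A n) := ⊤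

section Chain

variable {S : Type u} {O : Type w} {A : Type v}

/-- The law of the record up to time `0`: the state is drawn from `init`, then the action from the
policy. -/
def initialRecord (obs : S → O) (init : PMF S) (π : Policy O A) : PMF (Record S A 0) :=
  init.bind fun s =>
    (π 0 (fun _ => obs s, Fin.elim0)).bind fun a => PMF.pure fun _ => (s, a)

/-- The law of the record up to time `n + 1` given the record `r` up to time `n`: the new state is
drawn from `q` at the last state and action, then the new action from the policy at the
observations of all states so far and all earlier actions. -/
def extendRecord (obs : S → O) (q : S → A → PMF S) (π : Policy O A) (n : ℕ)
    (r : Record S A n) : PMF (Record S A (n + 1)) :=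
  (q (r (Fin.last n)).1 (r (Fin.last n)).2).bind fun s =>
    (π (n + 1)
        (Fin.snoc (α := fun _ => O) (fun i => obs (r i).1) (obs s), fun i => (r i).2)).bind fun a =>
      PMF.pure (Fin.snoc (α := fun _ => S × A) r (s, a))

/-- `extendRecord`, as a kernel that depends on the past through the current record only. -/
def extendKernel (obs : S → O) (q : S → A → PMF S) (π : Policy O A) (n : ℕ) :
    Kernel (∀ i : Finset.Iic n, Record S A i) (Record S A (n + 1)) where
  toFun h := (extendRecord obs q π n (h ⟨n, Finset.mem_Iic.2 le_rfl⟩)).toMeasure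
  measurable' :=
    (measurable_from_top (f := fun r : Record S A n => (extendRecord obs q π n r).toMeasure)).comp
      (measurable_pi_apply _)

instance (obs : S → O) (q : S → A → PMF S) (π : Policy O A) (n : ℕ) :
    IsMarkovKernel (extendKernel obs q π n) :=
  ⟨fun h => PMF.toMeasure.isProbabilityMeasure
    (extendRecord obs q π n (h ⟨n, Finset.mem_Iic.2 le_rfl⟩))⟩

/-- The law of the controlled chain over the infinite horizon (Ionescu-Tulcea), on sequences
`ω` in which `ω t` is the record up to time `t`. -/
def pathMeasure (obs : S → O) (q : S → A → PMF S) (init : PMF S) (π : Policy O A) :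
    Measure (∀ n, Record S A n) :=
  Kernel.trajMeasure (initialRecord obs init π).toMeasure (extendKernel obs q π)

/-- The state at time `t`. -/
def stateAt (t : ℕ) (ω : ∀ n, Record S A n) : S := (ω t (Fin.last t)).1

/-- The action at time `t`. -/
def actionAt (t : ℕ) (ω : ∀ n, Record S A n) : A := (ω t (Fin.last t)).2

/-- The expected total discounted cost of a policy. Costs are nonnegative, so the series and the
expectation are taken in `[0, ∞]`. -/
def discountedCost (obs : S → O) (q : S → A → PMF S) (cost : S → A → ℝ≥0∞) (β : ℝ≥0)
    (init : PMF S) (π : Policy O A) : ℝ≥0∞ :=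
  ∫⁻ ω, ∑' t : ℕ, (β : ℝ≥0∞) ^ t * cost (stateAt t ω) (actionAt t ω)
    ∂(pathMeasure obs q init π)

end Chain

/-! ## Local state information and the belief-augmented problem -/

section Model

variable {Xo : Type u} {Xu : Type w} {A : Type v}

/-- The objective of the local-state-information problem: the observable substate starts at `x₀`,
the unobservable one has initial law `α`, and the policy sees the observable substates only. -/
def localValue (p : Xo → Xu → A → PMF (Xo × Xu)) (c : Xo → Xu → A → ℝ≥0) (β : ℝ≥0)
    (α : PMF Xu) (x₀ : Xo) (π : Policy Xo A) : ℝ≥0∞ :=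
  discountedCost (S := Xo × Xu) Prod.fst (fun x a => p x.1 x.2 a) (fun x a => (c x.1 x.2 a : ℝ≥0∞))
    β (α.map fun xu => (x₀, xu)) π

/-- The law of the next observable substate given `(x, b)` and `a`:
`p(x' | x, b, a) = ∑ p(x', xu' | x, xu, a) b(xu)`, summed over `xu` and `xu'`. -/
def obsLaw (p : Xo → Xu → A → PMF (Xo × Xu)) (x : Xo) (b : PMF Xu) (a : A) : PMF Xo :=
  (b.bind fun xu => p x xu a).map Prod.fst

variable [Fintype Xu]

/-- The numerator of the belief update:
`∑ p(x', xu' | x, xu, a) b(xu)`, summed over `xu`. -/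
def beliefWeight (p : Xo → Xu → A → PMF (Xo × Xu)) (x' x : Xo) (b : PMF Xu) (a : A)
    (xu' : Xu) : ℝ≥0∞ :=
  ∑ xu : Xu, p x xu a (x', xu') * b xu

theorem tsum_beliefWeight_ne_top (p : Xo → Xu → A → PMF (Xo × Xu)) (x' x : Xo) (b : PMF Xu)
    (a : A) : ∑' xu', beliefWeight p x' x b a xu' ≠ ∞ := by
  rw [tsum_fintype]
  refine ENNReal.sum_ne_top.2 fun xu' _ => ENNReal.sum_ne_top.2 fun xu _ => ?_
  exact ENNReal.mul_ne_top (PMF.apply_ne_top _ _) (PMF.apply_ne_top _ _)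

open Classical in
/-- The belief update `T(x', x, b, a)`: the normalized weights. If the weights vanish (so that `x'`
has probability zero) Bayes' rule is undefined, and the belief is kept by convention. -/
def beliefUpdate (p : Xo → Xu → A → PMF (Xo × Xu)) (x' x : Xo) (b : PMF Xu) (a : A) : PMF Xu :=
  if h : ∑' xu', beliefWeight p x' x b a xu' = 0 then b
  else PMF.normalize (beliefWeight p x' x b a) h (tsum_beliefWeight_ne_top p x' x b a)

/-- The transition law of the augmented state `(x, b)`: the observable substate moves according to
`p(x' | x, b, a)` and the belief moves to `T(x', x, b, a)`. -/
def augTransition (p : Xo → Xu → A → PMF (Xo × Xu)) (s : Xo × PMF Xu) (a : A) :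
    PMF (Xo × PMF Xu) :=
  (obsLaw p s.1 s.2 a).map fun x' => (x', beliefUpdate p x' s.1 s.2 a)

/-- The belief-averaged cost `c̄(x, b, a) = ∑ b(xu) c(x, xu, a)`, summed over `xu`. -/
def augCost (c : Xo → Xu → A → ℝ≥0) (s : Xo × PMF Xu) (a : A) : ℝ≥0∞ :=
  ∑ xu : Xu, s.2 xu * c s.1 xu a

/-- The objective of the belief-augmented problem started at `(x₀, b₀)`; the policy sees the whole
augmented state. -/
def augValue (p : Xo → Xu → A → PMF (Xo × Xu)) (c : Xo → Xu → A → ℝ≥0) (β : ℝ≥0)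
    (x₀ : Xo) (b₀ : PMF Xu) (π : Policy (Xo × PMF Xu) A) : ℝ≥0∞ :=
  discountedCost id (augTransition p) (augCost c) β (PMF.pure (x₀, b₀)) π

/-- The optimal value of the belief-augmented problem started at `(x₀, b₀)`. -/
def augOptimalValue (p : Xo → Xu → A → PMF (Xo × Xu)) (c : Xo → Xu → A → ℝ≥0) (β : ℝ≥0)
    (x₀ : Xo) (b₀ : PMF Xu) : ℝ≥0∞ :=
  ⨅ π : Policy (Xo × PMF Xu) A, augValue p c β x₀ b₀ π

end Model

end LSI

end

open MeasureTheory ProbabilityTheory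
open scoped NNReal ENNReal

noncomputable section

namespace LSI

universe u v w

/-! In both problems the cost of a policy is a discounted series of expected stage costs, so only
finite-horizon laws matter (`discountedCost_eq_tsum`). By Bayes' rule the unobservable substate,
given the history and the action, has the belief as its law (`stageExpect_filter`). Hence under
every local policy the pair of observable substate and belief has, in expectation, the costs and
transitions of the augmented chain: it is an information state. In the augmented problem the current
state trivially is one.

One verification argument then serves both problems. Let `v` be the least solution of the Bellman
equation. Since `v ≤ k + β P v` for every action, iterating gives `v ≤ cost` for every policy, the
remainder vanishing because `v` is bounded and `β < 1`. Actions being finite, some `d` attains the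
minimum in every state; iterating the equality along `d` gives `cost ≤ v`. Both optimal values are
therefore `v`, and `d` is optimal. -/

/-! ## Expectations under a `PMF` -/

section Expect

variable {X : Type u} {Y : Type v}

/-- The expectation of a `[0, ∞]`-valued function under a `PMF`. -/
def expect (p : PMF X) (f : X → ℝ≥0∞) : ℝ≥0∞ :=
  ∑' x, p x * f x

theorem expect_pure (x : X) (f : X → ℝ≥0∞) : expect (PMF.pure x) f = f x := by
  rw [expect, tsum_eq_single x fun y hy => by simp [PMF.pure_apply_of_ne _ _ hy]]
  simp

theorem expect_bind (p : PMF X) (g : X → PMF Y) (f : Y → ℝ≥0∞) :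
    expect (p.bind g) f = expect p fun x => expect (g x) f := by
  simp only [expect, PMF.bind_apply, ← ENNReal.tsum_mul_right, ← ENNReal.tsum_mul_left, mul_assoc]
  exact ENNReal.tsum_comm

theorem expect_map (p : PMF X) (g : X → Y) (f : Y → ℝ≥0∞) :
    expect (p.map g) f = expect p fun x => f (g x) := by
  rw [← PMF.bind_pure_comp, expect_bind]
  simp [expect_pure]

theorem expect_const (p : PMF X) (c : ℝ≥0∞) : expect p (fun _ => c) = c := by
  rw [expect, ENNReal.tsum_mul_right, p.tsum_coe, one_mul]

theorem expect_mono (p : PMF X) {f g : X → ℝ≥0∞} (h : ∀ x, f x ≤ g x) :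
    expect p f ≤ expect p g :=
  ENNReal.tsum_le_tsum fun x => mul_le_mul_right (h x) _

theorem expect_add (p : PMF X) (f g : X → ℝ≥0∞) :
    expect p (fun x => f x + g x) = expect p f + expect p g := by
  simp only [expect, mul_add, ENNReal.tsum_add]

theorem expect_mul_left (p : PMF X) (c : ℝ≥0∞) (f : X → ℝ≥0∞) :
    expect p (fun x => c * f x) = c * expect p f := by
  simp only [expect, mul_left_comm _ c, ENNReal.tsum_mul_left]

theorem expect_comm (p : PMF X) (q : PMF Y) (f : X → Y → ℝ≥0∞) :
    (expect p fun x => expect q fun y => f x y) = expect q fun y => expect p fun x => f x y := by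
  simp only [expect, ← ENNReal.tsum_mul_left]
  rw [ENNReal.tsum_comm]
  simp only [mul_left_comm]

/-- The measure is a sum of weighted Dirac masses, so neither countability of `X` nor measurable
singletons are needed; the belief space has no preferred σ-algebra. -/
theorem lintegral_toMeasure [MeasurableSpace X] (p : PMF X) {f : X → ℝ≥0∞} (hf : Measurable f) :
    ∫⁻ x, f x ∂p.toMeasure = expect p f := by
  have h : p.toMeasure = Measure.sum fun x => p x • Measure.dirac x := by
    ext s hs
    rw [PMF.toMeasure_apply _ hs, Measure.sum_apply _ hs]
    refine tsum_congr fun x => ?_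
    rw [Measure.smul_apply, Measure.dirac_apply' _ hs]
    by_cases hx : x ∈ s <;> simp [hx]
  rw [h, lintegral_sum_measure]
  exact tsum_congr fun x => by rw [lintegral_smul_measure, lintegral_dirac' _ hf, smul_eq_mul]

end Expect

/-! ## Finite-horizon laws of a controlled chain -/

section Chain

variable {S : Type u} {O : Type w} {A : Type v}

/-- The law of the record up to time `n`. -/
def recordLaw (obs : S → O) (q : S → A → PMF S) (init : PMF S) (π : Policy O A) :
    (n : ℕ) → PMF (Record S A n)
  | 0 => initialRecord obs init π
  | n + 1 => (recordLaw obs q init π n).bind (extendRecord obs q π n)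

theorem pathMeasure_map_zero (obs : S → O) (q : S → A → PMF S) (init : PMF S) (π : Policy O A) :
    (pathMeasure obs q init π).map (fun ω => ω 0) = (initialRecord obs init π).toMeasure := by
  have h : (fun ω : ∀ n, Record S A n => ω 0) =
      (fun h : ∀ i : Finset.Iic 0, Record S A i => h ⟨0, Finset.mem_Iic.2 le_rfl⟩) ∘
        Preorder.frestrictLe 0 := rfl
  rw [h, ← Measure.map_map (by fun_prop) (by fun_prop), pathMeasure, Kernel.trajMeasure,
    Measure.map_comp _ _ (by fun_prop), Kernel.traj_map_frestrictLe, Kernel.partialTraj_self,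
    Measure.id_comp]
  exact (Measure.map_map (measurable_pi_apply _) (MeasurableEquiv.measurable _)).trans
    Measure.map_id

/-- Marginal of the joint law of the first coordinates and the next one. A coordinate is itself a
whole record, so single-coordinate marginals satisfy a closed recursion. -/
theorem pathMeasure_map_succ (obs : S → O) (q : S → A → PMF S) (init : PMF S) (π : Policy O A)
    (n : ℕ) {s : Set (Record S A (n + 1))} :
    (pathMeasure obs q init π).map (fun ω => ω (n + 1)) s =
      ∫⁻ r, (extendRecord obs q π n r).toMeasure s
        ∂(pathMeasure obs q init π).map (fun ω => ω n) := by
  have hs : MeasurableSet s := MeasurableSpace.measurableSet_top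
  have h := Kernel.map_frestrictLe_trajMeasure_compProd_eq_map_trajMeasure
    (μ₀ := (initialRecord obs init π).toMeasure) (κ := extendKernel obs q π) (a := n)
  have h' := congrArg (fun μ => μ.map Prod.snd s) h
  rw [Measure.map_map (by fun_prop) (by fun_prop), ← Measure.snd, Measure.snd_compProd,
    Measure.bind_apply hs (Kernel.aemeasurable _),
    lintegral_map (Kernel.measurable_coe _ hs) (by fun_prop)] at h'
  rw [lintegral_map measurable_from_top (by fun_prop)]
  exact h'.symm

theorem pathMeasure_map (obs : S → O) (q : S → A → PMF S) (init : PMF S) (π : Policy O A) (n : ℕ) :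
    (pathMeasure obs q init π).map (fun ω => ω n) = (recordLaw obs q init π n).toMeasure := by
  induction n with
  | zero => exact pathMeasure_map_zero obs q init π
  | succ n ih =>
    ext s hs
    rw [pathMeasure_map_succ, ih, lintegral_toMeasure _ measurable_from_top, recordLaw,
      PMF.toMeasure_bind_apply _ _ _ hs]
    rfl

/-- Tonelli, all costs being nonnegative. From here on the path measure is no longer needed. -/
theorem discountedCost_eq_tsum (obs : S → O) (q : S → A → PMF S) (cost : S → A → ℝ≥0∞) (β : ℝ≥0)
    (init : PMF S) (π : Policy O A) :
    discountedCost obs q cost β init π =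
      ∑' t : ℕ, (β : ℝ≥0∞) ^ t * expect (recordLaw obs q init π t)
        fun r => cost (r (Fin.last t)).1 (r (Fin.last t)).2 := by
  have hm (t : ℕ) : Measurable fun r : Record S A t =>
    cost (r (Fin.last t)).1 (r (Fin.last t)).2 := measurable_from_top
  have hm' (t : ℕ) : Measurable fun ω : ∀ n, Record S A n =>
      cost (stateAt t ω) (actionAt t ω) := (hm t).comp (measurable_pi_apply t)
  rw [discountedCost, lintegral_tsum fun t => ((hm' t).const_mul _).aemeasurable]
  refine tsum_congr fun t => ?_
  rw [lintegral_const_mul _ (hm' t), ← lintegral_toMeasure _ (hm t), ← pathMeasure_map,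
    lintegral_map (hm t) (measurable_pi_apply t)]
  rfl

/-- What the controller has seen along a record, before the last action. -/
def Record.history (obs : S → O) {n : ℕ} (r : Record S A n) : History O A n :=
  (fun i => obs (r i).1, fun i => (r i.castSucc).2)

/-- The history after one more action and observation. -/
def extendHistory {n : ℕ} (h : History O A n) (a : A) (o : O) : History O A (n + 1) :=
  (Fin.snoc (α := fun _ => O) h.1 o, Fin.snoc (α := fun _ => A) h.2 a)

/-- The record after one more state and action. -/
def Record.snoc {n : ℕ} (r : Record S A n) (x : S × A) : Record S A (n + 1) :=
  Fin.snoc (α := fun _ => S × A) r x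

@[simp]
theorem Record.snoc_last {n : ℕ} (r : Record S A n) (x : S × A) :
    r.snoc x (Fin.last (n + 1)) = x :=
  Fin.snoc_last (α := fun _ => S × A) x r

@[simp]
theorem Record.snoc_castSucc {n : ℕ} (r : Record S A n) (x : S × A) (i : Fin (n + 1)) :
    r.snoc x i.castSucc = r i :=
  Fin.snoc_castSucc (α := fun _ => S × A) x r i

theorem Record.history_snoc (obs : S → O) {n : ℕ} (r : Record S A n) (s : S) (a : A) :
    (r.snoc (s, a)).history obs =
      extendHistory (r.history obs) (r (Fin.last n)).2 (obs s) := by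
  refine Prod.ext (funext fun i => ?_) (funext fun i => ?_)
  · induction i using Fin.lastCases <;> simp [Record.history, extendHistory]
  · induction i using Fin.lastCases <;> simp only [Record.history, extendHistory,
      Record.snoc_castSucc, Fin.snoc_last, Fin.snoc_castSucc]

theorem extendRecord_eq (obs : S → O) (q : S → A → PMF S) (π : Policy O A) {n : ℕ}
    (r : Record S A n) :
    extendRecord obs q π n r = (q (r (Fin.last n)).1 (r (Fin.last n)).2).bind fun s =>
      (π (n + 1) (extendHistory (r.history obs) (r (Fin.last n)).2 (obs s))).map fun a =>
        r.snoc (s, a) := by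
  have h (s : S) : ((Fin.snoc (α := fun _ => O) (fun i => obs (r i).1) (obs s),
      fun i => (r i).2) : History O A (n + 1)) =
        extendHistory (r.history obs) (r (Fin.last n)).2 (obs s) := by
    refine Prod.ext rfl (funext fun i => ?_)
    induction i using Fin.lastCases <;> simp [Record.history, extendHistory]
  simp only [← h]
  rfl

/-- The record of one state and one action. -/
def Record.single (x : S × A) : Record S A 0 :=
  fun _ => x

theorem Record.history_single (obs : S → O) (s : S) (a : A) :
    (Record.single (s, a)).history obs = (fun _ => obs s, Fin.elim0) :=
  Prod.ext rfl (Subsingleton.elim _ _)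

theorem initialRecord_eq (obs : S → O) (init : PMF S) (π : Policy O A) :
    initialRecord obs init π = init.bind fun s =>
      (π 0 (fun _ => obs s, Fin.elim0)).map fun a => Record.single (s, a) :=
  rfl

/-- The expectation at time `n` of a function of the history, the state and the action. -/
def stageExpect (obs : S → O) (q : S → A → PMF S) (init : PMF S) (π : Policy O A) (n : ℕ)
    (F : History O A n → S → A → ℝ≥0∞) : ℝ≥0∞ :=
  expect (recordLaw obs q init π n)
    fun r => F (r.history obs) (r (Fin.last n)).1 (r (Fin.last n)).2

variable (obs : S → O) (q : S → A → PMF S) (init : PMF S) (π : Policy O A)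

theorem stageExpect_zero (F : History O A 0 → S → A → ℝ≥0∞) :
    stageExpect obs q init π 0 F =
      expect init fun s => expect (π 0 (fun _ => obs s, Fin.elim0)) fun a =>
        F (fun _ => obs s, Fin.elim0) s a := by
  rw [stageExpect, recordLaw, initialRecord_eq, expect_bind]
  congr 1; funext s
  rw [expect_map]
  simp only [Record.history_single]
  rfl

theorem stageExpect_succ (n : ℕ) (F : History O A (n + 1) → S → A → ℝ≥0∞) :
    stageExpect obs q init π (n + 1) F =
      stageExpect obs q init π n fun h s a => expect (q s a) fun s' =>
        expect (π (n + 1) (extendHistory h a (obs s'))) fun a' =>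
          F (extendHistory h a (obs s')) s' a' := by
  rw [stageExpect, recordLaw, expect_bind, stageExpect]
  congr 1; funext r
  rw [extendRecord_eq, expect_bind]
  congr 1; funext s
  rw [expect_map]
  simp only [Record.history_snoc, Record.snoc_last]

/-- The action is drawn from a law depending on the history alone, so it can be averaged out with
the history and the state held fixed. -/
theorem stageExpect_action (n : ℕ) (F : History O A n → S → A → ℝ≥0∞) :
    stageExpect obs q init π n F =
      stageExpect obs q init π n fun h s _ => expect (π n h) fun a => F h s a := by
  cases n with
  | zero => simp only [stageExpect_zero, expect_const]
  | succ n => simp only [stageExpect_succ, expect_const]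

theorem stageExpect_mono (n : ℕ) {F G : History O A n → S → A → ℝ≥0∞}
    (h : ∀ k s a, F k s a ≤ G k s a) :
    stageExpect obs q init π n F ≤ stageExpect obs q init π n G :=
  expect_mono _ fun _ => h _ _ _

theorem stageExpect_add_mul (n : ℕ) (F G : History O A n → S → A → ℝ≥0∞) (c : ℝ≥0∞) :
    (stageExpect obs q init π n fun h s a => F h s a + c * G h s a) =
      stageExpect obs q init π n F + c * stageExpect obs q init π n G := by
  simp only [stageExpect, expect_add, expect_mul_left]

end Chain

/-! ## Discounted sums -/

/-- After `n` iterations the remainder is at most `β ^ n * M`, which tends to `0` because `M` is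
finite. -/
theorem le_tsum_of_le_add_mul {W k : ℕ → ℝ≥0∞} {β M : ℝ≥0∞} (hβ : β < 1) (hM : M ≠ ∞)
    (hW : ∀ n, W n ≤ M) (h : ∀ n, W n ≤ k n + β * W (n + 1)) : W 0 ≤ ∑' n, β ^ n * k n := by
  have key (n : ℕ) : W 0 ≤ ∑ i ∈ Finset.range n, β ^ i * k i + β ^ n * W n := by
    induction n with
    | zero => simp
    | succ n ih =>
      refine ih.trans ?_
      rw [Finset.sum_range_succ, add_assoc]
      gcongr
      calc β ^ n * W n ≤ β ^ n * (k n + β * W (n + 1)) := by gcongr; exact h n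
        _ = _ := by ring
  have lim : Filter.Tendsto (fun n => ∑' i, β ^ i * k i + β ^ n * M) Filter.atTop
      (nhds (∑' i, β ^ i * k i)) := by
    have h0 := ENNReal.Tendsto.mul_const (b := M) (ENNReal.tendsto_pow_atTop_nhds_zero_of_lt_one hβ)
      (Or.inr hM)
    simpa using h0.const_add (∑' i, β ^ i * k i)
  refine ge_of_tendsto' lim fun n => (key n).trans ?_
  gcongr
  · exact ENNReal.sum_le_tsum _
  · exact hW n

/-- Here the remainder is nonnegative and is simply dropped, so no bound on `W` or `β` is required.
-/
theorem tsum_le_of_add_mul_le {W k : ℕ → ℝ≥0∞} {β : ℝ≥0∞}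
    (h : ∀ n, k n + β * W (n + 1) ≤ W n) : ∑' n, β ^ n * k n ≤ W 0 := by
  have key (n : ℕ) : ∑ i ∈ Finset.range n, β ^ i * k i + β ^ n * W n ≤ W 0 := by
    induction n with
    | zero => simp
    | succ n ih =>
      refine le_trans ?_ ih
      rw [Finset.sum_range_succ, add_assoc]
      gcongr
      calc _ = β ^ n * (k n + β * W (n + 1)) := by ring
        _ ≤ _ := by gcongr; exact h n
  rw [ENNReal.tsum_eq_iSup_nat]
  exact iSup_le fun n => le_self_add.trans (key n)

/-! ## Verification through an information state -/

section Verification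

variable {S : Type u} {O : Type w} {A : Type v} {T : Type*}

/-- `σ` is an information state of a controlled chain under the policy `π`: in expectation, costs
and transitions are those of a chain on `T` with cost `k` and transition law `P`, started at
`t₀`. -/
structure IsInformationState (obs : S → O) (q : S → A → PMF S) (cost : S → A → ℝ≥0∞)
    (init : PMF S) (π : Policy O A) (σ : ∀ n, History O A n → T) (k : T → A → ℝ≥0∞)
    (P : T → A → PMF T) (t₀ : T) : Prop where
  start (f : T → ℝ≥0∞) : (stageExpect obs q init π 0 fun h _ _ => f (σ 0 h)) = f t₀
  step (n : ℕ) (f : T → ℝ≥0∞) :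
    (stageExpect obs q init π (n + 1) fun h _ _ => f (σ (n + 1) h)) =
      stageExpect obs q init π n fun h _ a => expect (P (σ n h) a) f
  cost_eq (n : ℕ) :
    (stageExpect obs q init π n fun _ s a => cost s a) =
      stageExpect obs q init π n fun h _ a => k (σ n h) a

variable {obs : S → O} {q : S → A → PMF S} {cost : S → A → ℝ≥0∞} {init : PMF S} {π : Policy O A}
  {σ : ∀ n, History O A n → T} {k : T → A → ℝ≥0∞} {P : T → A → PMF T} {t₀ : T} {v : T → ℝ≥0∞}
  {β : ℝ≥0}

theorem IsInformationState.discountedCost_eq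
    (hσ : IsInformationState obs q cost init π σ k P t₀) :
    discountedCost obs q cost β init π = ∑' n, (β : ℝ≥0∞) ^ n *
      stageExpect obs q init π n fun h _ a => k (σ n h) a := by
  rw [discountedCost_eq_tsum]
  exact tsum_congr fun n => congrArg _ (hσ.cost_eq n)

theorem IsInformationState.le_discountedCost
    (hσ : IsInformationState obs q cost init π σ k P t₀) (hβ : β < 1) {M : ℝ≥0∞} (hM : M ≠ ∞)
    (hvM : ∀ t, v t ≤ M) (hv : ∀ t a, v t ≤ k t a + β * expect (P t a) v) :
    v t₀ ≤ discountedCost obs q cost β init π := by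
  rw [hσ.discountedCost_eq, ← hσ.start v]
  refine le_tsum_of_le_add_mul
    (W := fun n => stageExpect obs q init π n fun h _ _ => v (σ n h)) (by exact_mod_cast hβ) hM
    (fun n => (expect_mono _ fun _ => hvM _).trans_eq (expect_const _ _)) fun n => ?_
  rw [hσ.step, ← stageExpect_add_mul]
  exact stageExpect_mono _ _ _ _ _ fun _ _ _ => hv _ _

theorem IsInformationState.discountedCost_le
    (hσ : IsInformationState obs q cost init π σ k P t₀) {d : T → A}
    (hπ : ∀ n h, π n h = PMF.pure (d (σ n h)))
    (hv : ∀ t, k t (d t) + β * expect (P t (d t)) v ≤ v t) :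
    discountedCost obs q cost β init π ≤ v t₀ := by
  rw [hσ.discountedCost_eq, ← hσ.start v]
  refine tsum_le_of_add_mul_le
    (W := fun n => stageExpect obs q init π n fun h _ _ => v (σ n h)) fun n => ?_
  -- The inequality for `v` is known at the action `d` only, so the action is first averaged under
  -- the policy.
  rw [hσ.step, ← stageExpect_add_mul, stageExpect_action]
  refine stageExpect_mono _ _ _ _ _ fun h _ _ => ?_
  rw [hπ, expect_pure]
  exact hv _

/-- The current state is an information state of a fully observed chain. -/
theorem isInformationState_id (q : S → A → PMF S) (cost : S → A → ℝ≥0∞) (s₀ : S)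
    (π : Policy S A) :
    IsInformationState id q cost (PMF.pure s₀) π (fun n h => h.1 (Fin.last n)) cost q s₀ where
  start f := by simp only [stageExpect_zero, expect_const, expect_pure, id]
  step n f := by
    simp only [stageExpect_succ, expect_const, extendHistory, Fin.snoc_last, id]
    rfl
  cost_eq n := rfl

end Verification

/-! ## The optimality equation -/

section Bellman

variable {T : Type u} {A : Type v}

/-- The Bellman operator of a controlled chain. -/
def bellman (k : T → A → ℝ≥0∞) (P : T → A → PMF T) (β : ℝ≥0) : (T → ℝ≥0∞) →o (T → ℝ≥0∞) where
  toFun f t := ⨅ a, k t a + β * expect (P t a) f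
  monotone' _ _ h t := iInf_mono fun a => by gcongr; exact expect_mono _ h

/-- The least solution of the optimality equation. -/
def bellmanValue (k : T → A → ℝ≥0∞) (P : T → A → PMF T) (β : ℝ≥0) : T → ℝ≥0∞ :=
  (bellman k P β).lfp

variable (k : T → A → ℝ≥0∞) (P : T → A → PMF T) (β : ℝ≥0)

theorem bellmanValue_eq (t : T) :
    bellmanValue k P β t = ⨅ a, k t a + β * expect (P t a) (bellmanValue k P β) :=
  (congrFun (bellman k P β).map_lfp t).symm

theorem bellmanValue_le (t : T) (a : A) :
    bellmanValue k P β t ≤ k t a + β * expect (P t a) (bellmanValue k P β) :=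
  (bellmanValue_eq k P β t).trans_le (iInf_le _ a)

theorem exists_bellmanValue_eq [Finite A] [Nonempty A] (t : T) :
    ∃ a, k t a + β * expect (P t a) (bellmanValue k P β) = bellmanValue k P β t := by
  rw [bellmanValue_eq k P β t]
  exact exists_eq_ciInf_of_finite

/-- The constant `C / (1 - β)`, written as a geometric series, is mapped below itself by the Bellman
operator, hence dominates its least fixed point. -/
theorem exists_bellmanValue_le [Nonempty A] (hβ : β < 1) {C : ℝ≥0} (hC : ∀ t a, k t a ≤ C) :
    ∃ M : ℝ≥0∞, M ≠ ∞ ∧ ∀ t, bellmanValue k P β t ≤ M := by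
  refine ⟨C * ∑' n, (β : ℝ≥0∞) ^ n, ?_, ?_⟩
  · rw [ENNReal.tsum_geometric]
    refine ENNReal.mul_ne_top ENNReal.coe_ne_top (ENNReal.inv_ne_top.2 ?_)
    exact (tsub_pos_of_lt (by exact_mod_cast hβ)).ne'
  · refine (bellman k P β).lfp_le (a := fun _ => C * ∑' n, (β : ℝ≥0∞) ^ n) fun t => ?_
    refine (iInf_le _ (Classical.arbitrary A)).trans ?_
    rw [expect_const]
    have h : ∑' n, (β : ℝ≥0∞) ^ n = 1 + β * ∑' n, (β : ℝ≥0∞) ^ n := by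
      rw [← ENNReal.tsum_mul_left, tsum_eq_zero_add' ENNReal.summable, pow_zero]
      simp only [pow_succ']
    calc k t _ + β * (C * ∑' n, (β : ℝ≥0∞) ^ n) ≤ C + β * (C * ∑' n, (β : ℝ≥0∞) ^ n) := by
          gcongr; exact hC _ _
      _ = C * (1 + β * ∑' n, (β : ℝ≥0∞) ^ n) := by ring
      _ = _ := by rw [← h]

end Bellman

/-! ## Filtering the unobservable substate -/

section Filter

variable {Xo : Type u} {Xu : Type w} {A : Type v} [Fintype Xu]
  (p : Xo → Xu → A → PMF (Xo × Xu))

/-- The belief about the unobservable substate given a history. -/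
def belief (α : PMF Xu) : (n : ℕ) → History Xo A n → PMF Xu
  | 0, _ => α
  | n + 1, h => beliefUpdate p (h.1 (Fin.last _)) (h.1 (Fin.last n).castSucc)
      (belief α n (fun i => h.1 i.castSucc, fun i => h.2 i.castSucc)) (h.2 (Fin.last n))

/-- The augmented state after a history. -/
def augState (α : PMF Xu) (n : ℕ) (h : History Xo A n) : Xo × PMF Xu :=
  (h.1 (Fin.last n), belief p α n h)

theorem belief_extendHistory (α : PMF Xu) (n : ℕ) (h : History Xo A n) (a : A) (x' : Xo) :
    belief p α (n + 1) (extendHistory h a x') =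
      beliefUpdate p x' (h.1 (Fin.last n)) (belief p α n h) a := by
  simp [belief, extendHistory]

theorem beliefWeight_eq (x' x : Xo) (b : PMF Xu) (a : A) (xu' : Xu) :
    beliefWeight p x' x b a xu' = (b.bind fun xu => p x xu a) (x', xu') := by
  rw [beliefWeight, PMF.bind_apply, tsum_fintype]
  exact Finset.sum_congr rfl fun _ _ => mul_comm _ _

theorem obsLaw_eq (x' x : Xo) (b : PMF Xu) (a : A) :
    obsLaw p x b a x' = ∑' xu', beliefWeight p x' x b a xu' := by
  classical
  rw [obsLaw, PMF.map_apply, ENNReal.tsum_prod', tsum_eq_single x']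
  · simp [beliefWeight_eq]
  · intro y hy
    simp [hy.symm]

/-- Where `x'` has probability zero both sides vanish, so the conventional value of the update is
harmless. -/
theorem obsLaw_mul_beliefUpdate (x' x : Xo) (b : PMF Xu) (a : A) (xu' : Xu) :
    obsLaw p x b a x' * beliefUpdate p x' x b a xu' = beliefWeight p x' x b a xu' := by
  rw [obsLaw_eq, beliefUpdate]
  split_ifs with h
  · rw [h, zero_mul, ENNReal.tsum_eq_zero.1 h]
  · rw [PMF.normalize_apply, mul_comm, mul_assoc,
      ENNReal.inv_mul_cancel h (tsum_beliefWeight_ne_top p x' x b a), mul_one]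

/-- Bayes' rule: drawing the next state is drawing the next observable substate and then the
unobservable one from the updated belief. -/
theorem expect_disintegrate (x : Xo) (b : PMF Xu) (a : A) (f : Xo → Xu → ℝ≥0∞) :
    (expect b fun xu => expect (p x xu a) fun s' => f s'.1 s'.2) =
      expect (obsLaw p x b a) fun x' => expect (beliefUpdate p x' x b a) (f x') := by
  rw [← expect_bind, expect, ENNReal.tsum_prod']
  refine tsum_congr fun x' => ?_
  simp only [expect, ← ENNReal.tsum_mul_left]
  refine tsum_congr fun xu' => ?_
  rw [← mul_assoc, obsLaw_mul_beliefUpdate, beliefWeight_eq]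

variable (α : PMF Xu) (x₀ : Xo) (π : Policy Xo A)

/-- Given the history and the action, the unobservable substate has the belief as its law. -/
theorem stageExpect_filter (n : ℕ) (F : History Xo A n → Xu → A → ℝ≥0∞) :
    (stageExpect (S := Xo × Xu) Prod.fst (fun x a => p x.1 x.2 a) (α.map fun xu => (x₀, xu)) π n
        fun h s a => F h s.2 a) =
      stageExpect (S := Xo × Xu) Prod.fst (fun x a => p x.1 x.2 a) (α.map fun xu => (x₀, xu)) π n
        fun h _ a => expect (belief p α n h) fun xu => F h xu a := by
  induction n with
  | zero =>
    simp only [stageExpect_zero, expect_map, expect_const, belief]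
    rw [expect_comm]
  | succ n ih =>
    have key (G : History Xo A (n + 1) → Xu → A → ℝ≥0∞) :
        (stageExpect (S := Xo × Xu) Prod.fst (fun x a => p x.1 x.2 a)
          (α.map fun xu => (x₀, xu)) π (n + 1) fun h s a => G h s.2 a) =
        stageExpect (S := Xo × Xu) Prod.fst (fun x a => p x.1 x.2 a)
          (α.map fun xu => (x₀, xu)) π n fun h _ a =>
            expect (obsLaw p (h.1 (Fin.last n)) (belief p α n h) a) fun x' =>
              expect (π (n + 1) (extendHistory h a x')) fun a' =>
                expect (belief p α (n + 1) (extendHistory h a x')) fun xu =>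
                  G (extendHistory h a x') xu a' := by
      rw [stageExpect_succ]
      refine (ih fun h xu a => expect (p (h.1 (Fin.last n)) xu a) fun s' =>
        expect (π (n + 1) (extendHistory h a s'.1)) fun a' =>
          G (extendHistory h a s'.1) s'.2 a').trans ?_
      congr 1; funext h _ a
      rw [expect_disintegrate p _ _ a fun x' xu' =>
        expect (π (n + 1) (extendHistory h a x')) fun a' => G (extendHistory h a x') xu' a']
      congr 1; funext x'
      -- The new action and the unobservable substate may be swapped because the policy does not see
      -- the latter.
      rw [expect_comm, belief_extendHistory]
    -- Averaging over the belief twice is the same as once, so both sides reduce to the same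
    -- expression.
    rw [key, key fun h _ a => expect (belief p α (n + 1) h) fun xu => F h xu a]
    simp only [expect_const]

/-- The augmented state is an information state of the local-state-information problem. -/
theorem isInformationState_augState (c : Xo → Xu → A → ℝ≥0) :
    IsInformationState (S := Xo × Xu) Prod.fst (fun x a => p x.1 x.2 a)
      (fun x a => (c x.1 x.2 a : ℝ≥0∞)) (α.map fun xu => (x₀, xu)) π (augState p α)
      (augCost c) (augTransition p) (x₀, α) where
  start f := by
    simp only [stageExpect_zero, expect_const, expect_map, augState, belief]
  step n f := by
    simp only [stageExpect_succ, expect_const, augState, belief_extendHistory]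
    refine (stageExpect_filter p α x₀ π n fun h xu a => expect (p (h.1 (Fin.last n)) xu a)
      fun s' => f ((extendHistory h a s'.1).1 (Fin.last (n + 1)),
        beliefUpdate p s'.1 (h.1 (Fin.last n)) (belief p α n h) a)).trans ?_
    congr 1; funext h _ a
    -- The integrand ignores the new unobservable substate, so the inner average over the updated
    -- belief is trivial.
    rw [expect_disintegrate p _ _ a fun x' _ => f ((extendHistory h a x').1 (Fin.last (n + 1)),
      beliefUpdate p x' (h.1 (Fin.last n)) (belief p α n h) a)]
    simp only [expect_const, augTransition, expect_map, extendHistory, Fin.snoc_last]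
  cost_eq n := by
    refine (stageExpect_filter p α x₀ π n fun h xu a => (c (h.1 (Fin.last n)) xu a : ℝ≥0∞)).trans ?_
    simp only [augCost, augState, expect, tsum_fintype]

end Filter

/-- There are infinitely many beliefs in general, but a belief average of `c` never exceeds the
finite sum of all its values. -/
theorem exists_augCost_le {Xo Xu A : Type*} [Fintype Xo] [Fintype Xu] [Fintype A]
    (c : Xo → Xu → A → ℝ≥0) : ∃ C : ℝ≥0, ∀ s a, augCost c s a ≤ C := by
  refine ⟨∑ x, ∑ xu, ∑ a, c x xu a, fun s a => ?_⟩
  rw [augCost, ← tsum_fintype (L := .unconditional _)]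
  refine (expect_mono s.2 fun xu => ?_).trans_eq (expect_const s.2 _)
  norm_cast
  calc c s.1 xu a ≤ ∑ a, c s.1 xu a := Finset.single_le_sum (fun _ _ => zero_le) (Finset.mem_univ a)
    _ ≤ ∑ xu, ∑ a, c s.1 xu a :=
      Finset.single_le_sum (f := fun xu => ∑ a, c s.1 xu a) (fun _ _ => zero_le)
        (Finset.mem_univ xu)
    _ ≤ _ := Finset.single_le_sum (f := fun x => ∑ xu, ∑ a, c x xu a) (fun _ _ => zero_le)
        (Finset.mem_univ s.1)

end LSI

end

open LSI in
theorem theorem2 {Xo Xu A : Type*} [Fintype Xo] [Fintype Xu] [Fintype A] [Nonempty A]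
    (p : Xo → Xu → A → PMF (Xo × Xu)) (c : Xo → Xu → A → ℝ≥0)
    (β : ℝ≥0) (hβ : β < 1) (α : PMF Xu) (x₀ : Xo) :
    -- the local-state-information problem and the belief-augmented problem have the same
    -- (finite) optimal value
    (⨅ π : Policy Xo A, localValue p c β α x₀ π) = augOptimalValue p c β x₀ α ∧
    augOptimalValue p c β x₀ α ≠ ∞ ∧
    -- Markov deterministic policies suffice, and one of them attains the optimal value
    augOptimalValue p c β x₀ α =
      (⨅ d : MarkovPolicy (Xo × PMF Xu) A, augValue p c β x₀ α d.toPolicy) ∧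
    (∃ d : MarkovPolicy (Xo × PMF Xu) A,
      augValue p c β x₀ α d.toPolicy = augOptimalValue p c β x₀ α) ∧
    -- the optimal value solves the Bellman equation (with a minimum over the actions) at every
    -- augmented state
    (∀ (x : Xo) (b : PMF Xu),
      IsLeast
        (Set.range fun a : A =>
          augCost c (x, b) a +
            β * ∑' s' : Xo × PMF Xu, augOptimalValue p c β s'.1 s'.2 * augTransition p (x, b) a s')
        (augOptimalValue p c β x b)) := by
  set v := bellmanValue (augCost c) (augTransition p) β
  obtain ⟨C, hC⟩ := exists_augCost_le c
  obtain ⟨M, hM, hvM⟩ := exists_bellmanValue_le (augCost c) (augTransition p) β hβ hC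
  have hv := bellmanValue_le (augCost c) (augTransition p) β
  choose d hd using exists_bellmanValue_eq (augCost c) (augTransition p) β
  have lower (x b) (π : Policy (Xo × PMF Xu) A) : v (x, b) ≤ augValue p c β x b π :=
    (isInformationState_id (augTransition p) (augCost c) (x, b) π).le_discountedCost hβ hM hvM hv
  have attained (x b) :
      augValue p c β x b (MarkovPolicy.toPolicy fun _ => d) = v (x, b) :=
    le_antisymm ((isInformationState_id (augTransition p) (augCost c) (x, b) _).discountedCost_le
      (d := d) (fun _ _ => rfl) fun t => (hd t).le) (lower x b _)
  have value (x b) : augOptimalValue p c β x b = v (x, b) :=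
    le_antisymm ((iInf_le _ _).trans_eq (attained x b)) (le_iInf (lower x b))
  refine ⟨?_, ?_, ?_, ⟨fun _ => d, ?_⟩, fun x b => ?_⟩
  · rw [value]
    -- The optimal local policy computes the belief from its own history and plays `d` there.
    refine le_antisymm ((iInf_le _ fun n h => PMF.pure (d (augState p α n h))).trans ?_)
      (le_iInf fun π => ?_)
    · exact (isInformationState_augState p α x₀ _ c).discountedCost_le (d := d) (fun _ _ => rfl)
        fun t => (hd t).le
    · exact (isInformationState_augState p α x₀ π c).le_discountedCost hβ hM hvM hv
  · rw [value]
    exact ne_top_of_le_ne_top hM (hvM _)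
  · rw [value]
    exact le_antisymm (le_iInf fun _ => lower _ _ _) ((iInf_le _ fun _ => d).trans_eq (attained _ _))
  · rw [value, attained]
  · have h (a : A) : ∑' s' : Xo × PMF Xu, augOptimalValue p c β s'.1 s'.2 *
        augTransition p (x, b) a s' = expect (augTransition p (x, b) a) v :=
      tsum_congr fun s' => by rw [value, mul_comm]
    simp only [h]
    rw [value]
    exact ⟨⟨d (x, b), hd (x, b)⟩, Set.forall_mem_range.2 fun a => hv (x, b) a⟩
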